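/- For an integer $d\ge 1$ let $\mathcal G_d=\{\mathcal N(\mu,\Sigma):\mu\in\mathbb R^d,\ \Sigma\in\mathbb R^{d\times d}\text{ symmetric positive definite}\}$, and for distributions on $\mathbb R^d$ with densities $f_1,f_2$ let $d_{TV}(f_1,f_2)=\frac12\int_{\mathbb R^d}|f_1-f_2|\,dx$. A class $\mathcal F$ of distributions is $(L,m,\alpha,\beta,\gamma)$-list-decodable with respect to $d_{TV}$ if there is a (possibly randomized) algorithm such that, for every $f\in\mathcal F$ and every distribution $h$, given $m$ i.i.d. samples from $(1-\gamma)f+\gamma h$, it outputs a list of at most $L$ members of $\mathcal F$ which, with probability at least $1-\beta$ over the samples and the algorithm's randomness, contains some $\hat f$ with $d_{TV}(\hat f,f)\le\alpha$. Lemma 7.4. There are universal constants $C>0$ and $p\in\mathbb N$ such that for all $d\ge1$ and all $\alpha,\beta\in(0,1)$ the class $\mathcal G_d$ is $(L,m,\alpha,\beta,0)$-list-decodable with respect to $d_{TV}$ for some integers $m,L\geq 0$ with $$m\le C\,d\,\max\{1,\log(1/\beta)\},\qquad L\le \big(\max\{2,\ d\log(1/\beta)\}\big)^{\,C\,g\,(1+\log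 g)^p},\qquad g=d^2\max\{1,\log(1/\alpha)\}.$$ That is, $m=O(d\log(1/\beta))$ and $L=(d\log(1/\beta))^{\tilde O(d^2\log(1/\alpha))}$, where $\tilde O(g)$ means at most a universal constant times $g$ times a fixed power of $1+\log g$, and where $\log(1/\alpha)$ and $\log(1/\beta)$ are replaced by $1$ when smaller than $1$, and the base of the power by $2$ when smaller than $2$. -/

import Mathlib

open MeasureTheory ProbabilityTheory

noncomputable section

/-- A list of at most `L` distributions on `X`: its length `n ≤ L` and its `n` entries. -/
abbrev CandidateList (X : Type*) [MeasurableSpace X] (L : ℕ) : Type _ :=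
  Σ n : Fin (L + 1), Fin n → Measure X

/-- Huber's additive contamination `(1 - γ) f + γ h` of `f` by `h` at level `γ`. -/
def huberMixture {X : Type*} [MeasurableSpace X] (γ : ℝ) (f h : Measure X) : Measure X :=
  ENNReal.ofReal (1 - γ) • f + ENNReal.ofReal γ • h

/-- The (possibly randomized) algorithm `A`, a measurable map that takes a random seed, uniform on
`[0, 1]`, and a sample of size `m`, and outputs a list of at most `L` distributions, is an
`(L, m, α, β, γ)`-list-decoding algorithm for the class `F` with respect to `κ`. It only outputs
lists of members of `F`, and for every `f ∈ F` and every distribution `h`, on `m` i.i.d. samples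
from `(1 - γ) f + γ h`, the probability (over the seed and the sample) that no entry of the list is
`α`-close to `f` is at most `β`. -/
structure IsListDecodingAlgorithm {X : Type*} [MeasurableSpace X]
    (F : Set (Measure X)) (κ : Measure X → Measure X → ℝ) (L m : ℕ) (α β γ : ℝ)
    (A : unitInterval × (Fin m → X) → CandidateList X L) : Prop where
  measurable : Measurable A
  output_mem : ∀ ω, ∀ i, (A ω).2 i ∈ F
  failure_le : ∀ f ∈ F, ∀ h : Measure X, IsProbabilityMeasure h →
    ((volume : Measure unitInterval).prod
        (Measure.pi (fun _ : Fin m => huberMixture γ f h)))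
      {ω | ¬ ∃ i, κ ((A ω).2 i) f ≤ α} ≤ ENNReal.ofReal β

/-- The class `F` is `(L, m, α, β, γ)`-list-decodable with respect to `κ`. -/
def IsListDecodable {X : Type*} [MeasurableSpace X]
    (F : Set (Measure X)) (κ : Measure X → Measure X → ℝ) (L m : ℕ) (α β γ : ℝ) : Prop :=
  ∃ A : unitInterval × (Fin m → X) → CandidateList X L,
    IsListDecodingAlgorithm F κ L m α β γ A

/-- The total variation distance `(1/2) ∫ |f₁ - f₂|` of two absolutely continuous distributions
on `ℝ^d`, where `f₁` and `f₂` are their densities with respect to Lebesgue measure. -/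
def tvDist {d : ℕ} (P Q : Measure (EuclideanSpace ℝ (Fin d))) : ℝ :=
  (1 / 2) * ∫ x, |(P.rnDeriv volume x).toReal - (Q.rnDeriv volume x).toReal|

/-- The class of all Gaussians `N(μ, S)` on `ℝ^d` with positive definite covariance matrix `S`. -/
def gaussianClass (d : ℕ) : Set (Measure (EuclideanSpace ℝ (Fin d))) :=
  {P | ∃ (μ : EuclideanSpace ℝ (Fin d)) (S : Matrix (Fin d) (Fin d) ℝ),
    S.PosDef ∧ P = multivariateGaussian μ S}

/-- `polylogBound C p g = C g (1 + log g)^p`; a quantity is `Õ(g)`, for `g ≥ 1`, when it is at most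
`polylogBound C p g` for some universal constants `C` and `p`. -/
def polylogBound (C : ℝ) (p : ℕ) (g : ℝ) : ℝ := C * g * (1 + Real.log g) ^ p

end

/-! ### Total variation between a standard Gaussian and a small affine perturbation of it. -/

section TotalVariation

open Real

/-! The sample is cut into `k = ⌈2 log (1/β)⌉` independent blocks of `d + 1` points. Write a block
as `x i = μ + R z i` with `z i` standard Gaussian, and let `D` be the matrix of differences `z i - z
0`. If `D` is invertible there are a vector `v` and a matrix `A` with `z 0 + D v = 0` and `D A = 1`.
Affine equivariance then expresses the unknown Gaussian through the observed block with coefficients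
`v` and `A`, which depend only on `z` and not on `μ` or `R`.

With probability at least 1/2 a block is good (`measure_goodBlock_compl_le`), and then the
coefficients are polynomially bounded in `d` (`exists_inverse_of_mem_goodBlock`). So it suffices to
try all coefficients on a grid of polynomial size and mesh. A rounding error replaces the standard
Gaussian by the law of `a + B Z` with `a` near 0 and `B` near 1, which costs at most `α` in total
variation (`tvDist_map_affine_stdGaussian_le`, `tvDist_blockCandidate_le`).

The deterministic algorithm lists every grid candidate of every block. It fails only if all blocks
are bad, which has probability at most `2^(-k) ≤ β`. There are `d + d²` coefficients, each with
`poly(d, 1/α)` grid values, which gives the list length (`listLength_le`). -/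

theorem abs_norm_sq_sub_norm_sq_le {E : Type*} [NormedAddCommGroup E]
    [NormedSpace ℝ E] {a : E} {B : E ≃L[ℝ] E} {ε : ℝ} (hε : ε ≤ 1 / 2)
    (ha : ‖a‖ ≤ ε) (hB : ∀ y, ‖B y - y‖ ≤ ε * ‖y‖) (x : E) :
    |(‖x‖ ^ 2 - ‖B.symm (x - a)‖ ^ 2) / 2| ≤ 5 * ε * (1 + ‖x‖ ^ 2) := by
  set y := B.symm (x - a) with hy
  have hx : x - y = a + (B y - y) := by
    rw [hy, B.apply_symm_apply]
    abel
  have hε0 : 0 ≤ ε := (norm_nonneg _).trans ha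
  have hxy : ‖x - y‖ ≤ ε * (1 + ‖y‖) := by
    rw [hx]
    refine (norm_add_le _ _).trans ?_
    linarith [hB y]
  have h1 : |‖x‖ - ‖y‖| ≤ ε * (1 + ‖y‖) := (abs_norm_sub_norm_le x y).trans hxy
  have hx0 := norm_nonneg x
  have hy0 := norm_nonneg y
  -- Since `ε ≤ 1/2`, the term `ε ‖y‖` on the right is absorbed on the left.
  have hy2 : ‖y‖ ≤ 2 * ‖x‖ + 1 := by
    have := (abs_le.1 h1).1
    nlinarith
  have h2 : |(‖x‖ ^ 2 - ‖y‖ ^ 2) / 2| = |‖x‖ - ‖y‖| * ((‖x‖ + ‖y‖) / 2) := by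
    have h3 := abs_of_nonneg (show 0 ≤ (‖x‖ + ‖y‖) / 2 by positivity)
    rw [show |‖x‖ - ‖y‖| * ((‖x‖ + ‖y‖) / 2) = |‖x‖ - ‖y‖| * |(‖x‖ + ‖y‖) / 2| by rw [h3],
      ← abs_mul]
    congr 1
    ring
  rw [h2]
  calc |‖x‖ - ‖y‖| * ((‖x‖ + ‖y‖) / 2)
      ≤ (ε * (1 + (2 * ‖x‖ + 1))) * ((‖x‖ + (2 * ‖x‖ + 1)) / 2) := by
        gcongr
        exact h1.trans (by gcongr)
    _ ≤ 5 * ε * (1 + ‖x‖ ^ 2) := by nlinarith [mul_nonneg hε0 (sq_nonneg (‖x‖ - 1))]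

variable {E : Type*} [NormedAddCommGroup E] [InnerProductSpace ℝ E] [FiniteDimensional ℝ E]
  [MeasurableSpace E] [BorelSpace E]

theorem map_withDensity_comp {X Y : Type*} [MeasurableSpace X] [MeasurableSpace Y]
    (μ : Measure X) {T : X → Y} (hT : Measurable T) {g : Y → ENNReal} (hg : Measurable g) :
    (μ.withDensity (g ∘ T)).map T = (μ.map T).withDensity g := by
  ext s hs
  rw [Measure.map_apply hT hs, withDensity_apply _ (hT hs), withDensity_apply _ hs,
    setLIntegral_map hs hg hT]
  rfl

/-- The standard Gaussian measure has density `(2π)^(-n/2) exp (-‖x‖² / 2)`. -/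
theorem stdGaussian_eq_withDensity :
    stdGaussian E = volume.withDensity (fun x : E => ENNReal.ofReal
      (((2 * π) ^ (Module.finrank ℝ E / 2 : ℝ))⁻¹ * exp (-(1 / 2) * ‖x‖ ^ 2))) := by
  set c : ℝ := (2 * π) ^ (Module.finrank ℝ E / 2 : ℝ) with hc
  have hcpos : 0 < c := by positivity
  have hint : ∫ v : E, exp (-(1 / 2) * ‖v‖ ^ 2) = c := by
    rw [GaussianFourier.integral_rexp_neg_mul_sq_norm (by norm_num), hc]
    congr 1
    ring
  -- The Bochner integral of a non-integrable function is 0, so a nonzero value proves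
  -- integrability.
  have hintg : Integrable (fun v : E => exp (-(1 / 2) * ‖v‖ ^ 2)) := by
    by_contra h
    rw [integral_undef h] at hint
    exact hcpos.ne hint
  have hfin : IsFiniteMeasure (volume.withDensity (fun x : E => ENNReal.ofReal
      (c⁻¹ * exp (-(1 / 2) * ‖x‖ ^ 2)))) :=
    isFiniteMeasure_withDensity_ofReal (hintg.const_mul _).2
  apply Measure.ext_of_charFun
  ext t
  rw [charFun_stdGaussian, charFun_apply, integral_withDensity_eq_integral_toReal_smul
    (by fun_prop) (by simp)]
  have h := GaussianFourier.integral_cexp_neg_mul_sq_norm_add (V := E) (b := (1 / 2 : ℂ))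
    (by norm_num) Complex.I t
  have hcc : (c : ℂ) = (π / (1 / 2 : ℂ)) ^ (Module.finrank ℝ E / 2 : ℂ) := by
    rw [hc, Complex.ofReal_cpow (by positivity)]
    push_cast
    congr 1
    ring
  rw [← hcc] at h
  have h2 : ∀ x : E, (ENNReal.ofReal (c⁻¹ * exp (-(1 / 2) * ‖x‖ ^ 2))).toReal •
      Complex.exp (inner ℝ x t * Complex.I) =
      (c : ℂ)⁻¹ * Complex.exp (-(1 / 2) * ‖x‖ ^ 2 + Complex.I * inner ℝ t x) := by
    intro x
    rw [ENNReal.toReal_ofReal (by positivity), Complex.real_smul, Complex.exp_add]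
    push_cast
    rw [real_inner_comm, mul_comm Complex.I]
    ring
  simp_rw [h2]
  rw [integral_const_mul, h, ← mul_assoc, inv_mul_cancel₀ (by exact_mod_cast hcpos.ne'), one_mul]
  congr 1
  rw [Complex.I_sq]
  ring

/-- The weight turns the density into an unnormalised Gaussian with parameter `1/2 - δ`. This serves
both the total variation bound and the tail bound on the norm. -/
theorem integral_exp_mul_norm_sq_stdGaussian {δ : ℝ} (hδ : δ < 1 / 2) :
    ∫ x : E, exp (δ * ‖x‖ ^ 2) ∂(stdGaussian E) =
      ((1 - 2 * δ) ^ (Module.finrank ℝ E / 2 : ℝ))⁻¹ := by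
  rw [stdGaussian_eq_withDensity, integral_withDensity_eq_integral_toReal_smul
    (by fun_prop) (by simp)]
  have h2 : ∀ x : E, (ENNReal.ofReal (((2 * π) ^ (Module.finrank ℝ E / 2 : ℝ))⁻¹ *
      exp (-(1 / 2) * ‖x‖ ^ 2))).toReal • exp (δ * ‖x‖ ^ 2) =
      ((2 * π) ^ (Module.finrank ℝ E / 2 : ℝ))⁻¹ * exp (-(1 / 2 - δ) * ‖x‖ ^ 2) := by
    intro x
    rw [ENNReal.toReal_ofReal (by positivity), smul_eq_mul, mul_assoc, ← exp_add]
    congr 2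
    ring
  simp_rw [h2]
  rw [integral_const_mul, GaussianFourier.integral_rexp_neg_mul_sq_norm (by linarith)]
  have h1 : π / (1 / 2 - δ) = 2 * π / (1 - 2 * δ) := by
    have : 1 - 2 * δ ≠ 0 := by linarith
    have : 1 / 2 - δ ≠ 0 := by linarith
    field_simp
  rw [h1, Real.div_rpow (by positivity) (by linarith), div_eq_mul_inv _ ((1 - 2 * δ) ^ _),
    ← mul_assoc, inv_mul_cancel₀ (by positivity), one_mul]

theorem integrable_exp_mul_norm_sq_stdGaussian {δ : ℝ} (hδ : δ < 1 / 2) :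
    Integrable (fun x : E => exp (δ * ‖x‖ ^ 2)) (stdGaussian E) := by
  by_contra h
  have h1 := integral_exp_mul_norm_sq_stdGaussian (E := E) hδ
  rw [integral_undef h] at h1
  have : 0 < (1 - 2 * δ) ^ (Module.finrank ℝ E / 2 : ℝ) := Real.rpow_pos_of_pos (by linarith) _
  exact (inv_pos.2 this).ne h1

/-- Only positivity of the Jacobian factor is recorded: where its value matters, total mass 1
determines it. -/
theorem map_affine_volume (a : E) (B : E ≃L[ℝ] E) :
    ∃ c : ℝ, 0 < c ∧ (volume : Measure E).map (fun x => a + B x) = ENNReal.ofReal c • volume := by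
  have hdet : LinearMap.det (B.toLinearEquiv : E →ₗ[ℝ] E) ≠ 0 :=
    (LinearEquiv.isUnit_det' B.toLinearEquiv).ne_zero
  refine ⟨|(LinearMap.det (B.toLinearEquiv : E →ₗ[ℝ] E))⁻¹|, by positivity, ?_⟩
  have h : (fun x => a + B x) = (fun x => a + x) ∘ (B.toLinearEquiv : E →ₗ[ℝ] E) := rfl
  rw [h, ← Measure.map_map (by fun_prop)
      (show Measurable (B.toLinearEquiv : E →ₗ[ℝ] E) from B.continuous.measurable),
    Measure.map_linearMap_addHaar_eq_smul_addHaar volume hdet, Measure.map_smul,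
    map_add_left_eq_self]

theorem map_affine_absolutelyContinuous (a : E) (B : E ≃L[ℝ] E) {P : Measure E}
    (hP : P ≪ volume) : P.map (fun x => a + B x) ≪ volume := by
  obtain ⟨c, -, hc⟩ := map_affine_volume a B
  have h := hP.map (f := fun x => a + B x) (by fun_prop)
  rw [hc] at h
  exact h.trans Measure.smul_absolutelyContinuous

theorem stdGaussian_absolutelyContinuous : stdGaussian E ≪ volume := by
  rw [stdGaussian_eq_withDensity]
  exact withDensity_absolutelyContinuous _ _

/-- An affine image of the standard Gaussian has density `c exp ((‖x‖² - ‖B⁻¹(x - a)‖²) / 2)` with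
respect to the standard Gaussian. -/
theorem map_affine_stdGaussian_eq_withDensity (a : E) (B : E ≃L[ℝ] E) :
    ∃ c : ℝ, 0 < c ∧ (stdGaussian E).map (fun x => a + B x) =
      (stdGaussian E).withDensity (fun x => ENNReal.ofReal
        (c * exp ((‖x‖ ^ 2 - ‖B.symm (x - a)‖ ^ 2) / 2))) := by
  obtain ⟨c, hc, hcv⟩ := map_affine_volume a B
  refine ⟨c, hc, ?_⟩
  set p : E → ENNReal := fun x : E => ENNReal.ofReal
      (((2 * π) ^ (Module.finrank ℝ E / 2 : ℝ))⁻¹ * exp (-(1 / 2) * ‖x‖ ^ 2)) with hp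
  have hpm : Measurable p := by fun_prop
  have h1 : p = (fun x => p (B.symm (x - a))) ∘ (fun x => a + B x) := by
    ext x
    simp
  have hSm : Measurable (fun x => B.symm (x - a)) := by fun_prop
  have hg : stdGaussian E = volume.withDensity p := stdGaussian_eq_withDensity
  have h2 : (stdGaussian E).map (fun x => a + B x) =
      (volume.map (fun x => a + B x)).withDensity (fun x => p (B.symm (x - a))) := by
    rw [← map_withDensity_comp _ (by fun_prop) (g := fun x => p (B.symm (x - a))) (hpm.comp hSm), hg]
    congr 2
  rw [h2, hcv, hg, withDensity_smul_measure, ← withDensity_smul _ (f := fun x => p (B.symm (x - a))) (hpm.comp hSm),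
    ← withDensity_mul _ hpm (by fun_prop)]
  congr 1
  ext x
  simp only [Pi.smul_apply, Pi.mul_apply, smul_eq_mul, hp]
  rw [← ENNReal.ofReal_mul hc.le, ← ENNReal.ofReal_mul (by positivity)]
  congr 1
  rw [show -(1 / 2) * ‖B.symm (x - a)‖ ^ 2 =
    -(1 / 2) * ‖x‖ ^ 2 + (‖x‖ ^ 2 - ‖B.symm (x - a)‖ ^ 2) / 2 by ring, exp_add]
  ring

/-- Total variation is invariant under a bijective change of variables: the relative density after
`T` is `r ∘ T⁻¹`, and the integral is pulled back to `Q`. This removes the unknown affine map from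
the error estimate. -/
theorem tvDist_map_withDensity {d : ℕ} {Q : Measure (EuclideanSpace ℝ (Fin d))}
    [IsFiniteMeasure Q] {r : EuclideanSpace ℝ (Fin d) → ENNReal} (hr : Measurable r)
    (T : EuclideanSpace ℝ (Fin d) ≃ᵐ EuclideanSpace ℝ (Fin d))
    (hQ : Q.map T ≪ volume) [IsFiniteMeasure (Q.withDensity r)] :
    tvDist ((Q.withDensity r).map T) (Q.map T) = 1 / 2 * ∫ x, |(r x).toReal - 1| ∂Q := by
  have hrT : Measurable (r ∘ T.symm) := hr.comp T.symm.measurable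
  have h1 : (Q.withDensity r).map T = (Q.map T).withDensity (r ∘ T.symm) := by
    rw [← map_withDensity_comp _ T.measurable hrT]
    congr 2
    ext x
    simp
  have hfin : IsFiniteMeasure ((Q.map T).withDensity (r ∘ T.symm)) := h1 ▸ inferInstance
  have h2 : ((Q.map T).withDensity (r ∘ T.symm)).rnDeriv volume =ᵐ[volume]
      fun x => (r ∘ T.symm) x * (Q.map T).rnDeriv volume x := by
    have h3 : (Q.map T).withDensity (r ∘ T.symm) =
        volume.withDensity ((Q.map T).rnDeriv volume * (r ∘ T.symm)) := by
      rw [withDensity_mul _ (Measure.measurable_rnDeriv _ _) hrT,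
        Measure.withDensity_rnDeriv_eq _ _ hQ]
    rw [h3]
    refine (Measure.rnDeriv_withDensity _ ((Measure.measurable_rnDeriv _ _).mul hrT)).trans ?_
    filter_upwards with x
    simp [mul_comm]
  rw [tvDist, h1]
  congr 1
  have h4 : ∫ x, |((r ∘ T.symm) x).toReal - 1| ∂(Q.map T) = ∫ x, |(r x).toReal - 1| ∂Q := by
    rw [integral_map_equiv]
    simp
  rw [← h4, ← integral_rnDeriv_smul hQ]
  refine integral_congr_ae ?_
  filter_upwards [h2] with x hx
  rw [hx, ENNReal.toReal_mul, smul_eq_mul]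
  conv_rhs => rw [← abs_of_nonneg (ENNReal.toReal_nonneg (a := (Q.map T).rnDeriv volume x)),
    ← abs_mul]
  congr 1
  ring

/-- If a probability density is proportional to `exp q` with `|q| ≤ G`, then it is close to `1` in
`L¹` as soon as `exp G` has integral close to `1`. -/
theorem integral_abs_mul_exp_sub_one_le {Ω : Type*} [MeasurableSpace Ω] {P : Measure Ω}
    [IsProbabilityMeasure P] {q G : Ω → ℝ} (hq : Measurable q) (hqG : ∀ x, |q x| ≤ G x)
    (hG : Integrable (fun x => exp (G x)) P) {c τ : ℝ} (hc : 0 < c)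
    (hone : ∫ x, c * exp (q x) ∂P = 1) (hτ : ∫ x, exp (G x) ∂P ≤ 1 + τ) (hτ2 : τ ≤ 1 / 2) :
    ∫ x, |c * exp (q x) - 1| ∂P ≤ 4 * τ := by
  -- The lower side uses `exp G + exp (-G) ≥ 2`.
  have hpt : ∀ x, |exp (q x) - 1| ≤ exp (G x) - 1 := by
    intro x
    have h := abs_le.1 (hqG x)
    have hG0 : 0 ≤ G x := (abs_nonneg _).trans (hqG x)
    have h1 : exp (q x) ≤ exp (G x) := exp_le_exp.2 h.2
    have h2 : exp (-G x) ≤ exp (q x) := exp_le_exp.2 h.1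
    have h3 : exp (G x) * exp (-G x) = 1 := by rw [← exp_add]; simp
    have h4 : 1 ≤ exp (G x) := one_le_exp hG0
    rw [abs_le]
    constructor
    · nlinarith [exp_pos (-G x), sq_nonneg (exp (G x) - 1)]
    · linarith
  have hqi : Integrable (fun x => exp (q x)) P := by
    refine hG.mono' (by fun_prop) (ae_of_all _ fun x => ?_)
    rw [norm_eq_abs, abs_of_pos (exp_pos _)]
    exact exp_le_exp.2 ((le_abs_self _).trans (hqG x))
  have hqi1 : Integrable (fun x => exp (q x) - 1) P := hqi.sub (integrable_const _)
  have hdev : ∫ x, |exp (q x) - 1| ∂P ≤ τ := by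
    have := integral_mono hqi1.abs (hG.sub (integrable_const (1 : ℝ))) hpt
    simp only [Pi.sub_apply] at this
    rw [integral_sub hG (integrable_const _)] at this
    simp at this
    linarith
  have hmean : |∫ x, exp (q x) ∂P - 1| ≤ τ := by
    have h := abs_integral_le_integral_abs (f := fun x => exp (q x) - 1) (μ := P)
    rw [integral_sub hqi (integrable_const _)] at h
    simp at h
    linarith
  -- The constant `c` is controlled only through `c * I = 1`: `|I - 1| ≤ τ ≤ 1/2` forces `c ≤ 2`,
  -- and `c e^q - 1 = c ((e^q - 1) - (I - 1))`.
  set I := ∫ x, exp (q x) ∂P with hI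
  have hcI : c * I = 1 := by rw [← hone, integral_const_mul]
  have hτ0 : 0 ≤ τ := (abs_nonneg _).trans hmean
  have hc2 : c ≤ 2 := by
    have := (abs_le.1 hmean).1
    nlinarith
  have hfinal : ∀ x, |c * exp (q x) - 1| ≤ c * (|exp (q x) - 1| + |I - 1|) := by
    intro x
    have : c * exp (q x) - 1 = c * ((exp (q x) - 1) - (I - 1)) := by linarith
    rw [this, abs_mul, abs_of_pos hc]
    exact mul_le_mul_of_nonneg_left (abs_sub _ _) hc.le
  calc ∫ x, |c * exp (q x) - 1| ∂P ≤ ∫ x, c * (|exp (q x) - 1| + |I - 1|) ∂P :=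
        integral_mono ((hqi.const_mul c).sub (integrable_const _)).abs
          ((hqi1.abs.add (integrable_const _)).const_mul _) hfinal
    _ = c * (∫ x, |exp (q x) - 1| ∂P + |I - 1|) := by
        rw [integral_const_mul, integral_add hqi1.abs (integrable_const _)]
        simp
    _ ≤ 2 * (τ + τ) := by
        apply mul_le_mul hc2 (add_le_add hdev hmean) (by positivity) (by norm_num)
    _ = 4 * τ := by ring

/-- Affine images under `T` of the standard Gaussian and of a small affine perturbation of it are
close in total variation. -/
theorem tvDist_map_affine_stdGaussian_le {d : ℕ} (hd : 1 ≤ d) {α : ℝ} (hα : 0 < α) (hα1 : α < 1)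
    (μ a : EuclideanSpace ℝ (Fin d))
    (R B : EuclideanSpace ℝ (Fin d) ≃L[ℝ] EuclideanSpace ℝ (Fin d))
    (ha : ‖a‖ ≤ α / (60 * d)) (hB : ∀ y, ‖B y - y‖ ≤ α / (60 * d) * ‖y‖) :
    tvDist (((stdGaussian _).map (fun x => a + B x)).map (fun x => μ + R x))
      ((stdGaussian _).map (fun x => μ + R x)) ≤ α := by
  obtain ⟨c, hc, hdens⟩ := map_affine_stdGaussian_eq_withDensity a B
  set ε := α / (60 * d) with hε
  have hd1 : (1 : ℝ) ≤ d := by exact_mod_cast hd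
  have hε0 : 0 < ε := by positivity
  have hεd : ε * d = α / 60 := by rw [hε]; field_simp
  have hε1 : ε ≤ 1 / 60 := by nlinarith
  set q : EuclideanSpace ℝ (Fin d) → ℝ := fun x => (‖x‖ ^ 2 - ‖B.symm (x - a)‖ ^ 2) / 2 with hq
  have hqm : Measurable q := by fun_prop
  change _ = (stdGaussian _).withDensity (fun x => ENNReal.ofReal (c * exp (q x))) at hdens
  let T : EuclideanSpace ℝ (Fin d) ≃ᵐ EuclideanSpace ℝ (Fin d) :=
    (R.toHomeomorph.trans (Homeomorph.addLeft μ)).toMeasurableEquiv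
  have hT : (fun x => μ + R x) = T := rfl
  have hprob : IsProbabilityMeasure ((stdGaussian (EuclideanSpace ℝ (Fin d))).withDensity
      (fun x => ENNReal.ofReal (c * exp (q x)))) := by
    rw [← hdens]
    exact Measure.isProbabilityMeasure_map (by fun_prop)
  rw [hdens, hT, tvDist_map_withDensity (by fun_prop) T
    (hT ▸ map_affine_absolutelyContinuous μ R stdGaussian_absolutelyContinuous)]
  have hnn : ∀ x, 0 ≤ c * exp (q x) := fun x => by positivity
  simp_rw [ENNReal.toReal_ofReal (hnn _)]
  have hone : ∫ x, c * exp (q x) ∂(stdGaussian (EuclideanSpace ℝ (Fin d))) = 1 := by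
    rw [integral_eq_lintegral_of_nonneg_ae (ae_of_all _ hnn) (by fun_prop)]
    have := hprob.measure_univ
    rw [withDensity_apply _ MeasurableSet.univ, Measure.restrict_univ] at this
    rw [this, ENNReal.toReal_one]
  have hG : (fun x : EuclideanSpace ℝ (Fin d) => exp (5 * ε * (1 + ‖x‖ ^ 2))) =
      fun x => exp (5 * ε) * exp (5 * ε * ‖x‖ ^ 2) := by
    ext x
    rw [← exp_add]
    ring_nf
  have hlt : 5 * ε < 1 / 2 := by linarith
  -- With `τ = α / 2` the `L¹` bound is `2 α`, and half of it is `α`.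
  have key := integral_abs_mul_exp_sub_one_le (P := stdGaussian (EuclideanSpace ℝ (Fin d)))
    (q := q) (G := fun x => 5 * ε * (1 + ‖x‖ ^ 2)) (τ := α / 2) hqm
    (abs_norm_sq_sub_norm_sq_le (by linarith) ha hB)
    (by rw [hG]; exact (integrable_exp_mul_norm_sq_stdGaussian hlt).const_mul _) hc hone
    (by
      rw [hG, integral_const_mul, integral_exp_mul_norm_sq_stdGaussian hlt, finrank_euclideanSpace,
        Fintype.card_fin]
      -- This bounds the Gaussian moment by `exp (10 ε d)`. The total exponent is then at most `15 ε
      -- d = α / 4`, which explains the 60 in `ε`.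
      have h1 : exp (-(20 * ε)) ≤ 1 - 2 * (5 * ε) := by
        have h3 : 0 < 1 - 2 * (5 * ε) := by linarith
        rw [← Real.le_log_iff_exp_le h3]
        have h4 := Real.one_sub_inv_le_log_of_pos h3
        refine le_trans ?_ h4
        have h5 : (1 - 2 * (5 * ε))⁻¹ ≤ 1 + 20 * ε := by
          rw [inv_le_iff_one_le_mul₀ h3]
          nlinarith
        linarith
      have h2 : ((1 - 2 * (5 * ε)) ^ ((d : ℝ) / 2))⁻¹ ≤ exp (10 * ε * d) := by
        rw [← Real.rpow_neg (by linarith)]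
        refine (Real.rpow_le_rpow_of_nonpos (exp_pos _) h1 (by linarith)).trans (le_of_eq ?_)
        rw [← Real.exp_mul]
        ring_nf
      calc exp (5 * ε) * ((1 - 2 * (5 * ε)) ^ ((d : ℝ) / 2))⁻¹
          ≤ exp (5 * ε) * exp (10 * ε * d) := by gcongr
        _ = exp (5 * ε + 10 * ε * d) := by rw [exp_add]
        _ ≤ exp (α / 4) := by
            apply exp_le_exp.2
            nlinarith
        _ ≤ 1 + α / 2 := by
            have h6 := Real.exp_bound_div_one_sub_of_interval (x := α / 4) (by linarith)
              (by linarith)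
            refine h6.trans ?_
            rw [div_le_iff₀ (by linarith)]
            nlinarith)
    (by linarith)
  linarith

end TotalVariation

/-! ### Gaussians as affine images of the standard one, and their measurable dependence on
parameters. -/

section Candidates

open Matrix

variable {d : ℕ}

/-- The affine map `y ↦ a + B y`. -/
noncomputable def affineImage (a : EuclideanSpace ℝ (Fin d)) (B : Matrix (Fin d) (Fin d) ℝ)
    (y : EuclideanSpace ℝ (Fin d)) : EuclideanSpace ℝ (Fin d) :=
  a + toEuclideanCLM (𝕜 := ℝ) B y

theorem continuous_affineImage :
    Continuous (fun p : (EuclideanSpace ℝ (Fin d) × Matrix (Fin d) (Fin d) ℝ) ×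
      EuclideanSpace ℝ (Fin d) => affineImage p.1.1 p.1.2 p.2) := by
  have : ∀ p : (EuclideanSpace ℝ (Fin d) × Matrix (Fin d) (Fin d) ℝ) × EuclideanSpace ℝ (Fin d),
      affineImage p.1.1 p.1.2 p.2 = p.1.1 + WithLp.toLp 2 (p.1.2 *ᵥ p.2.ofLp) := fun p => rfl
  simp_rw [this]
  fun_prop

theorem affineImage_affineImage (a b y : EuclideanSpace ℝ (Fin d))
    (A B : Matrix (Fin d) (Fin d) ℝ) :
    affineImage a A (affineImage b B y) = affineImage (affineImage a A b) (A * B) y := by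
  simp [affineImage, map_mul, add_assoc]

/-- A matrix with nonzero determinant as a continuous linear equivalence. -/
theorem exists_equiv_of_det_ne_zero {B : Matrix (Fin d) (Fin d) ℝ} (hB : B.det ≠ 0) :
    ∃ e : EuclideanSpace ℝ (Fin d) ≃L[ℝ] EuclideanSpace ℝ (Fin d),
      ∀ y, e y = toEuclideanCLM (𝕜 := ℝ) B y := by
  have hu : IsUnit B.det := isUnit_iff_ne_zero.2 hB
  refine ⟨ContinuousLinearEquiv.equivOfInverse (toEuclideanCLM (𝕜 := ℝ) B)
    (toEuclideanCLM (𝕜 := ℝ) B⁻¹) (fun y => ?_) (fun y => ?_), fun y => rfl⟩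
  · rw [← mul_apply_eq_comp, ← map_mul, nonsing_inv_mul _ hu, map_one]
    rfl
  · rw [← mul_apply_eq_comp, ← map_mul, mul_nonsing_inv _ hu, map_one]
    rfl

open Classical in
/-- The law of `a + B Z` for `Z` a standard Gaussian vector when `B` is invertible, and the standard
Gaussian distribution otherwise. -/
noncomputable def gaussianCandidate (a : EuclideanSpace ℝ (Fin d))
    (B : Matrix (Fin d) (Fin d) ℝ) : Measure (EuclideanSpace ℝ (Fin d)) :=
  if B.det ≠ 0 then (stdGaussian _).map (affineImage a B) else stdGaussian _

/-- The characteristic functions agree: `B` passes to the argument as `Bᵀ`, and `‖Bᵀ t‖² = ⟨t, B Bᵀ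
t⟩`. -/
theorem map_affineImage_stdGaussian (a : EuclideanSpace ℝ (Fin d)) (B : Matrix (Fin d) (Fin d) ℝ) :
    (stdGaussian _).map (affineImage a B) = multivariateGaussian a (B * Bᵀ) := by
  have hpsd : (B * Bᵀ).PosSemidef := by
    simpa [conjTranspose_eq_transpose_of_trivial] using posSemidef_self_mul_conjTranspose B
  apply Measure.ext_of_charFun
  ext t
  rw [charFun_multivariateGaussian hpsd]
  have hm : Measurable (affineImage a B) :=
    (continuous_affineImage.comp (Continuous.prodMk_right (a, B))).measurable
  rw [charFun_apply, integral_map hm.aemeasurable (by fun_prop)]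
  have h : ∀ x : EuclideanSpace ℝ (Fin d), Complex.exp (inner ℝ (affineImage a B x) t * Complex.I) =
      Complex.exp (inner ℝ t a * Complex.I) *
        Complex.exp (inner ℝ x (toEuclideanCLM (𝕜 := ℝ) Bᵀ t) * Complex.I) := by
    intro x
    rw [← Complex.exp_add, affineImage, inner_add_left, real_inner_comm, ← add_mul]
    congr 2
    push_cast
    congr 2
    rw [real_inner_comm, inner_toEuclideanCLM, inner_toEuclideanCLM, dotProduct_mulVec,
      ← mulVec_transpose, dotProduct_comm]
  simp_rw [h]
  rw [integral_const_mul, ← charFun_apply, charFun_stdGaussian, ← Complex.exp_add]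
  congr 1
  rw [sub_eq_add_neg, neg_div]
  congr 3
  rw [← Complex.ofReal_pow, ← real_inner_self_eq_norm_sq]
  congr 1
  have h2 : (toEuclideanCLM (𝕜 := ℝ) Bᵀ t).ofLp = Bᵀ *ᵥ t.ofLp := rfl
  rw [inner_toEuclideanCLM, ← mulVec_mulVec, dotProduct_mulVec _ B, h2, dotProduct_mulVec,
    vecMul_transpose, ← mulVec_transpose]
  rw [dotProduct_comm, dotProduct_mulVec, ← mulVec_transpose]

theorem gaussianCandidate_mem (a : EuclideanSpace ℝ (Fin d)) (B : Matrix (Fin d) (Fin d) ℝ) :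
    gaussianCandidate a B ∈ gaussianClass d := by
  rw [gaussianCandidate]
  split_ifs with h
  · refine ⟨a, B * Bᵀ, ?_, map_affineImage_stdGaussian a B⟩
    have := PosDef.mul_conjTranspose_self B (vecMul_injective_of_isUnit
      ((isUnit_iff_isUnit_det B).2 (isUnit_iff_ne_zero.2 h)))
    simpa [conjTranspose_eq_transpose_of_trivial] using this
  · exact ⟨0, 1, PosDef.one, multivariateGaussian_zero_one.symm⟩

/-- The singular parameters are the zero set of a continuous determinant. For the affine image, the
mass of a fixed Borel set is the Gaussian measure of a section of a Borel set in the product, which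
is measurable in the parameter. -/
theorem measurable_gaussianCandidate {Ω : Type*} [TopologicalSpace Ω] [SecondCountableTopology Ω]
    [MeasurableSpace Ω] [BorelSpace Ω] {a : Ω → EuclideanSpace ℝ (Fin d)}
    {B : Ω → Matrix (Fin d) (Fin d) ℝ} (ha : Continuous a) (hB : Continuous B) :
    Measurable (fun ω => gaussianCandidate (a ω) (B ω)) := by
  have hc : Continuous (fun p : Ω × EuclideanSpace ℝ (Fin d) => affineImage (a p.1) (B p.1) p.2) :=
    continuous_affineImage.comp (by fun_prop : Continuous
      fun p : Ω × EuclideanSpace ℝ (Fin d) => ((a p.1, B p.1), p.2))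
  refine Measurable.ite ?_ ?_ measurable_const
  · exact (measurableSet_singleton (0 : ℝ)).compl.preimage hB.matrix_det.measurable
  · refine Measure.measurable_of_measurable_coe _ fun s hs => ?_
    have h : ∀ ω, ((stdGaussian _).map (affineImage (a ω) (B ω))) s = (stdGaussian _) (Prod.mk ω ⁻¹'
        ((fun p : Ω × EuclideanSpace ℝ (Fin d) => affineImage (a p.1) (B p.1) p.2) ⁻¹' s)) := by
      intro ω
      rw [Measure.map_apply _ hs]
      · rfl
      · exact (hc.comp (Continuous.prodMk_right ω)).measurable
    simp_rw [h]
    exact measurable_measure_prodMk_left (hc.measurable hs)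

end Candidates

/-! ### Reconstructing a Gaussian from one block of `d + 1` points. -/

section Blocks

open Matrix

variable {d : ℕ}

/-- The matrix whose columns are the differences of the points of a block with its first point. -/
def differenceMatrix (x : Fin (d + 1) → EuclideanSpace ℝ (Fin d)) : Matrix (Fin d) (Fin d) ℝ :=
  Matrix.of fun r i => x i.succ r - x 0 r

/-- The candidate Gaussian obtained from a block of points with coefficients `v` and `M`. -/
noncomputable def blockCandidate (x : Fin (d + 1) → EuclideanSpace ℝ (Fin d))
    (v : EuclideanSpace ℝ (Fin d)) (M : Matrix (Fin d) (Fin d) ℝ) :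
    Measure (EuclideanSpace ℝ (Fin d)) :=
  gaussianCandidate (affineImage (x 0) (differenceMatrix x) v) (differenceMatrix x * M)

theorem continuous_differenceMatrix :
    Continuous (differenceMatrix : (Fin (d + 1) → EuclideanSpace ℝ (Fin d)) → _) := by
  refine continuous_matrix fun r i => ?_
  simp only [differenceMatrix, of_apply]
  fun_prop

theorem measurable_blockCandidate (v : EuclideanSpace ℝ (Fin d)) (M : Matrix (Fin d) (Fin d) ℝ) :
    Measurable (fun x => blockCandidate x v M) := by
  refine measurable_gaussianCandidate ?_ (continuous_differenceMatrix.matrix_mul continuous_const)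
  exact continuous_affineImage.comp (f := fun x : Fin (d + 1) → EuclideanSpace ℝ (Fin d) =>
    ((x 0, differenceMatrix x), v))
    (((continuous_apply 0).prodMk continuous_differenceMatrix).prodMk continuous_const)

theorem toEuclideanCLM_differenceMatrix (x : Fin (d + 1) → EuclideanSpace ℝ (Fin d))
    (w : EuclideanSpace ℝ (Fin d)) :
    toEuclideanCLM (𝕜 := ℝ) (differenceMatrix x) w = ∑ i, w i • (x i.succ - x 0) := by
  ext r
  change (differenceMatrix x *ᵥ w.ofLp) r = _
  simp [mulVec, dotProduct, differenceMatrix, mul_comm]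

theorem differenceMatrix_affineImage (μ : EuclideanSpace ℝ (Fin d)) (R : Matrix (Fin d) (Fin d) ℝ)
    (z : Fin (d + 1) → EuclideanSpace ℝ (Fin d)) :
    differenceMatrix (fun i => affineImage μ R (z i)) = R * differenceMatrix z := by
  ext r i
  simp [differenceMatrix, affineImage, mul_apply, mulVec, dotProduct, mul_sub]

/-- Affine equivariance of the reconstruction: the same coefficients applied to the standardised
block give the same candidate up to the unknown map, so errors can be measured on `z` alone. -/
theorem blockCandidate_affineImage {R : Matrix (Fin d) (Fin d) ℝ} (hR : R.det ≠ 0)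
    (μ v : EuclideanSpace ℝ (Fin d)) (z : Fin (d + 1) → EuclideanSpace ℝ (Fin d))
    {M : Matrix (Fin d) (Fin d) ℝ} (hM : (differenceMatrix z * M).det ≠ 0) :
    blockCandidate (fun i => affineImage μ R (z i)) v M =
      ((stdGaussian _).map (affineImage (affineImage (z 0) (differenceMatrix z) v)
        (differenceMatrix z * M))).map (affineImage μ R) := by
  have hm : ∀ (a : EuclideanSpace ℝ (Fin d)) (B : Matrix (Fin d) (Fin d) ℝ),
      Measurable (affineImage a B) := fun a B =>
    (continuous_affineImage.comp (Continuous.prodMk_right (a, B))).measurable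
  rw [blockCandidate, differenceMatrix_affineImage, gaussianCandidate, if_pos, Measure.map_map
    (hm _ _) (hm _ _), Matrix.mul_assoc]
  · congr 1
    ext1 y
    rw [Function.comp_apply, affineImage_affineImage μ, affineImage_affineImage]
  · rw [Matrix.mul_assoc, det_mul]
    exact mul_ne_zero hR hM

/-- Blocks of bounded points whose difference vectors are quantitatively linearly independent. -/
def goodBlock (d : ℕ) : Set (Fin (d + 1) → EuclideanSpace ℝ (Fin d)) :=
  {z | (∀ i, ‖z i‖ ≤ 4 * d) ∧ ∀ i : Fin d, ∃ u : EuclideanSpace ℝ (Fin d), ‖u‖ = 1 ∧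
    (∀ j, j ≠ i → inner ℝ u (z j.succ - z 0) = 0) ∧
      1 / (4 * d : ℝ) ≤ |inner ℝ u (z i.succ - z 0)|}

/-- The rows of the inverse form the dual basis of the differences. The unit vector `u i` kills
every difference but the `i`-th, so row `i` is `u i / s i`, with entries at most `1 / |s i| ≤ 4 d`.
Then `v = -A (z 0)`, where `‖z 0‖ ≤ 4 d`. -/
theorem exists_inverse_of_mem_goodBlock (hd : 1 ≤ d)
    {z : Fin (d + 1) → EuclideanSpace ℝ (Fin d)} (hz : z ∈ goodBlock d) :
    ∃ (v : EuclideanSpace ℝ (Fin d)) (A : Matrix (Fin d) (Fin d) ℝ),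
      affineImage (z 0) (differenceMatrix z) v = 0 ∧ differenceMatrix z * A = 1 ∧
      (∀ i, |v i| ≤ 16 * d ^ 2) ∧ ∀ i j, |A i j| ≤ 4 * d := by
  obtain ⟨hn, hu⟩ := hz
  choose u hu1 hu0 hu2 using hu
  have hd0 : (0 : ℝ) < d := by exact_mod_cast hd
  set s : Fin d → ℝ := fun i => inner ℝ (u i) (z i.succ - z 0) with hs
  have hs2 : ∀ i, |(s i)⁻¹| ≤ 4 * d := by
    intro i
    rw [abs_inv]
    refine inv_le_of_inv_le₀ (by positivity) ?_
    rw [← one_div]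
    exact hu2 i
  have hs0 : ∀ i, s i ≠ 0 := by
    intro i h
    have := hu2 i
    change _ ≤ |s i| at this
    rw [h, abs_zero] at this
    have : 0 < 1 / (4 * d : ℝ) := by positivity
    linarith
  set A : Matrix (Fin d) (Fin d) ℝ := Matrix.of fun i r => (s i)⁻¹ * u i r with hA
  have hAm : ∀ i (y : EuclideanSpace ℝ (Fin d)), (toEuclideanCLM (𝕜 := ℝ) A y) i =
      (s i)⁻¹ * inner ℝ (u i) y := by
    intro i y
    change (A *ᵥ y.ofLp) i = _
    simp only [mulVec, dotProduct, hA, of_apply, PiLp.inner_apply, Finset.mul_sum]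
    refine Finset.sum_congr rfl fun j _ => ?_
    simp
    ring
  have hAD : A * differenceMatrix z = 1 := by
    ext i j
    have h1 : (A * differenceMatrix z) i j =
        (toEuclideanCLM (𝕜 := ℝ) A (z j.succ - z 0)) i := by
      change _ = (A *ᵥ (z j.succ - z 0).ofLp) i
      simp [mul_apply, mulVec, dotProduct, differenceMatrix]
    rw [h1, hAm]
    by_cases hij : j = i
    · subst hij
      rw [one_apply_eq]
      exact inv_mul_cancel₀ (hs0 j)
    · rw [hu0 i j hij, mul_zero, one_apply_ne (Ne.symm hij)]
  have hDA : differenceMatrix z * A = 1 := mul_eq_one_comm.1 hAD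
  refine ⟨-toEuclideanCLM (𝕜 := ℝ) A (z 0), A, ?_, hDA, fun i => ?_, fun i j => ?_⟩
  · rw [affineImage, map_neg, ← mul_apply_eq_comp, ← map_mul, hDA, map_one]
    simp
  · rw [PiLp.neg_apply, abs_neg, hAm, abs_mul]
    calc |(s i)⁻¹| * |inner ℝ (u i) (z 0)| ≤ (4 * d) * (1 * (4 * d)) := by
          refine mul_le_mul (hs2 i) ((abs_real_inner_le_norm _ _).trans ?_) (abs_nonneg _)
            (by positivity)
          rw [hu1]
          gcongr
          exact hn 0
      _ = 16 * d ^ 2 := by ring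
  · rw [hA, of_apply, abs_mul]
    calc |(s i)⁻¹| * |u i j| ≤ (4 * d) * 1 := by
          refine mul_le_mul (hs2 i) ?_ (abs_nonneg _) (by positivity)
          rw [← hu1 i, ← Real.norm_eq_abs]
          exact PiLp.norm_apply_le _ _
      _ = 4 * d := by ring

theorem norm_toEuclideanCLM_differenceMatrix_le {z : Fin (d + 1) → EuclideanSpace ℝ (Fin d)}
    (hz : z ∈ goodBlock d) {w : EuclideanSpace ℝ (Fin d)} {η : ℝ} (hw : ∀ i, |w i| ≤ η) :
    ‖toEuclideanCLM (𝕜 := ℝ) (differenceMatrix z) w‖ ≤ 8 * d ^ 2 * η := by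
  rw [toEuclideanCLM_differenceMatrix]
  calc ‖∑ i, w i • (z i.succ - z 0)‖ ≤ ∑ i : Fin d, η * (8 * d) := by
        refine (norm_sum_le _ _).trans (Finset.sum_le_sum fun i _ => ?_)
        rw [norm_smul, Real.norm_eq_abs]
        refine mul_le_mul (hw i) ?_ (norm_nonneg _) ((abs_nonneg _).trans (hw i))
        refine (norm_sub_le _ _).trans ?_
        linarith [hz.1 i.succ, hz.1 0]
    _ = 8 * d ^ 2 * η := by
        simp
        ring

theorem det_ne_zero_of_norm_sub_le {B : Matrix (Fin d) (Fin d) ℝ} {ε : ℝ} (hε : ε < 1)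
    (hB : ∀ y, ‖toEuclideanCLM (𝕜 := ℝ) B y - y‖ ≤ ε * ‖y‖) : B.det ≠ 0 := by
  intro h
  obtain ⟨v, hv0, hv⟩ := exists_mulVec_eq_zero_iff.2 h
  have h1 : toEuclideanCLM (𝕜 := ℝ) B (WithLp.toLp 2 v) = 0 := by
    change WithLp.toLp 2 (B *ᵥ v) = 0
    rw [hv]
    rfl
  have h2 := hB (WithLp.toLp 2 v)
  rw [h1, zero_sub, norm_neg] at h2
  have h3 : 0 < ‖WithLp.toLp 2 v‖ := by
    rw [norm_pos_iff]
    simpa using hv0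
  nlinarith

/-- From a good block, coefficients close to the exact ones give a Gaussian close to the truth. -/
theorem tvDist_blockCandidate_le (hd : 1 ≤ d) {α : ℝ} (hα : 0 < α) (hα1 : α < 1)
    {R : Matrix (Fin d) (Fin d) ℝ} (hR : R.det ≠ 0) (μ : EuclideanSpace ℝ (Fin d))
    {z : Fin (d + 1) → EuclideanSpace ℝ (Fin d)} (hz : z ∈ goodBlock d)
    {v v' : EuclideanSpace ℝ (Fin d)} {A M : Matrix (Fin d) (Fin d) ℝ}
    (hv : affineImage (z 0) (differenceMatrix z) v = 0) (hA : differenceMatrix z * A = 1)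
    (hv' : ∀ i, |v' i - v i| ≤ α / (480 * d ^ 4)) (hM : ∀ i j, |M i j - A i j| ≤ α / (480 * d ^ 4)) :
    tvDist (blockCandidate (fun i => affineImage μ R (z i)) v' M)
      ((stdGaussian _).map (affineImage μ R)) ≤ α := by
  have hd1 : (1 : ℝ) ≤ d := by exact_mod_cast hd
  set a := affineImage (z 0) (differenceMatrix z) v' with ha
  set B := differenceMatrix z * M with hB
  have hae : ‖a‖ ≤ α / (60 * d) := by
    -- Exact coefficients give shift 0, so the shift is linear in the coefficient error.
    have h1 : a = toEuclideanCLM (𝕜 := ℝ) (differenceMatrix z) (v' - v) := by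
      rw [map_sub, ha, ← sub_zero (affineImage _ _ v'), ← hv, affineImage, affineImage]
      abel
    rw [h1]
    refine (norm_toEuclideanCLM_differenceMatrix_le hz hv').trans ?_
    rw [mul_div_assoc', div_le_div_iff₀ (by positivity) (by positivity)]
    have : (d : ℝ) ^ 3 ≤ d ^ 4 := pow_le_pow_right₀ hd1 (by norm_num)
    nlinarith
  -- Here `B - 1 = D (M - A)`. The mesh is chosen so that `8 d² · d · α / (480 d⁴) = α / (60 d)`.
  have hBe : ∀ y, ‖toEuclideanCLM (𝕜 := ℝ) B y - y‖ ≤ α / (60 * d) * ‖y‖ := by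
    intro y
    have h1 : toEuclideanCLM (𝕜 := ℝ) B y - y =
        toEuclideanCLM (𝕜 := ℝ) (differenceMatrix z) (toEuclideanCLM (𝕜 := ℝ) (M - A) y) := by
      rw [← mul_apply_eq_comp, ← map_mul, Matrix.mul_sub, hA, map_sub, map_one]
      rfl
    rw [h1]
    have h2 : ∀ i, |(toEuclideanCLM (𝕜 := ℝ) (M - A) y) i| ≤ d * (α / (480 * d ^ 4) * ‖y‖) := by
      intro i
      change |∑ j, (M - A) i j * y j| ≤ _
      calc |∑ j, (M - A) i j * y j| ≤ ∑ j : Fin d, α / (480 * d ^ 4) * ‖y‖ := by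
            refine (Finset.abs_sum_le_sum_abs _ _).trans (Finset.sum_le_sum fun j _ => ?_)
            rw [abs_mul]
            refine mul_le_mul (hM i j) ?_ (abs_nonneg _) (by positivity)
            rw [← Real.norm_eq_abs]
            exact PiLp.norm_apply_le _ _
        _ = d * (α / (480 * d ^ 4) * ‖y‖) := by simp
    refine (norm_toEuclideanCLM_differenceMatrix_le hz h2).trans (le_of_eq ?_)
    field_simp
    ring
  have hdet : B.det ≠ 0 := by
    refine det_ne_zero_of_norm_sub_le (ε := α / (60 * d)) ?_ hBe
    rw [div_lt_one (by positivity)]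
    linarith
  obtain ⟨eB, heB⟩ := exists_equiv_of_det_ne_zero hdet
  obtain ⟨eR, heR⟩ := exists_equiv_of_det_ne_zero hR
  have h := tvDist_map_affine_stdGaussian_le hd hα hα1 μ a eR eB hae
    (by simpa only [heB] using hBe)
  rw [blockCandidate_affineImage hR μ v' z hdet]
  simp only [heB, heR] at h
  exact h

end Blocks

/-! ### A block is good with probability at least 1/2, and blocks are independent. -/

section GoodBlockProbability

/-- The density is at most 1/2 and the interval has length `2 t`. -/
theorem gaussianReal_closedBall_le (b t : ℝ) :
    gaussianReal 0 1 {x | |x - b| ≤ t} ≤ ENNReal.ofReal t := by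
  have hset : {x | |x - b| ≤ t} = Set.Icc (b - t) (b + t) := by
    ext x
    simp only [Set.mem_ofPred_eq, abs_le, Set.mem_Icc]
    constructor <;> rintro ⟨h1, h2⟩ <;> constructor <;> linarith
  rw [hset, gaussianReal_apply _ one_ne_zero]
  have hpdf : ∀ x, gaussianPDF 0 1 x ≤ ENNReal.ofReal (1 / 2) := by
    intro x
    rw [gaussianPDF]
    apply ENNReal.ofReal_le_ofReal
    rw [gaussianPDFReal]
    have h1 : 2 ≤ √(2 * Real.pi * ((1 : NNReal) : ℝ)) := by
      apply Real.le_sqrt_of_sq_le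
      simp only [NNReal.coe_one]
      linarith [Real.pi_gt_three]
    have h2 : (√(2 * Real.pi * ((1 : NNReal) : ℝ)))⁻¹ ≤ 1 / 2 := by
      rw [one_div]
      exact inv_anti₀ (by norm_num) h1
    have h3 : Real.exp (-(x - 0) ^ 2 / (2 * ((1 : NNReal) : ℝ))) ≤ 1 := by
      rw [Real.exp_le_one_iff]
      simp only [NNReal.coe_one]
      nlinarith [sq_nonneg (x - 0)]
    calc _ ≤ (1 / 2 : ℝ) * 1 := mul_le_mul h2 h3 (Real.exp_nonneg _) (by norm_num)
      _ = 1 / 2 := by norm_num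
  calc ∫⁻ x in Set.Icc (b - t) (b + t), gaussianPDF 0 1 x
      ≤ ∫⁻ x in Set.Icc (b - t) (b + t), ENNReal.ofReal (1 / 2) :=
        lintegral_mono fun x => hpdf x
    _ = ENNReal.ofReal t := by
        rw [setLIntegral_const, Real.volume_Icc, ← ENNReal.ofReal_mul (by norm_num)]
        congr 1
        ring

variable {E : Type*} [NormedAddCommGroup E] [InnerProductSpace ℝ E] [FiniteDimensional ℝ E]
  [MeasurableSpace E] [BorelSpace E]

theorem stdGaussian_slab_le {u : E} (hu : ‖u‖ = 1) (b t : ℝ) :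
    stdGaussian E {x | |inner ℝ u x - b| ≤ t} ≤ ENNReal.ofReal t := by
  have h := IsGaussian.map_eq_gaussianReal (μ := stdGaussian E) (innerSL ℝ u)
  rw [variance_dual_stdGaussian, integral_strongDual_stdGaussian, innerSL_apply_norm, hu,
    one_pow, Real.toNNReal_one] at h
  refine le_trans (le_of_eq ?_) (gaussianReal_closedBall_le b t)
  rw [← h, Measure.map_apply (by fun_prop) (measurableSet_le (by fun_prop) measurable_const)]
  rfl

/-- Chernoff bound for `‖x‖²` with parameter 1/4: the factor `exp (-4 d²)` beats the moment `2^(d/2)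
≤ exp d`. -/
theorem stdGaussian_norm_gt_le {d : ℕ} (hd : 1 ≤ d) :
    stdGaussian (EuclideanSpace ℝ (Fin d)) {x | 4 * (d : ℝ) < ‖x‖} ≤
      ENNReal.ofReal (1 / (8 * d)) := by
  have hd1 : (1 : ℝ) ≤ d := by exact_mod_cast hd
  have h := measure_ge_le_exp_mul_mgf (μ := stdGaussian (EuclideanSpace ℝ (Fin d)))
    (X := fun x => ‖x‖ ^ 2) (t := 1 / 4) (16 * (d : ℝ) ^ 2) (by norm_num)
    (integrable_exp_mul_norm_sq_stdGaussian (by norm_num))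
  rw [mgf, integral_exp_mul_norm_sq_stdGaussian (by norm_num), finrank_euclideanSpace,
    Fintype.card_fin] at h
  have hsub : {x : EuclideanSpace ℝ (Fin d) | 4 * (d : ℝ) < ‖x‖} ⊆ {x | 16 * (d : ℝ) ^ 2 ≤ ‖x‖ ^ 2} := by
    intro x hx
    simp only [Set.mem_ofPred_eq] at hx ⊢
    nlinarith
  refine (measure_mono hsub).trans ?_
  rw [← ofReal_measureReal]
  refine ENNReal.ofReal_le_ofReal (h.trans ?_)
  have h1 : ((1 - 2 * (1 / 4 : ℝ)) ^ ((d : ℝ) / 2))⁻¹ ≤ Real.exp d := by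
    rw [← Real.rpow_neg (by norm_num)]
    have h2 : Real.exp (-1) ≤ 1 - 2 * (1 / 4 : ℝ) := by
      rw [Real.exp_neg]
      refine inv_le_of_inv_le₀ (by norm_num) ?_
      have := Real.add_one_le_exp 1
      norm_num at this ⊢
      linarith
    refine (Real.rpow_le_rpow_of_nonpos (Real.exp_pos _) h2 (by linarith)).trans ?_
    rw [← Real.exp_mul]
    apply Real.exp_le_exp.2
    linarith
  calc Real.exp (-(1 / 4) * (16 * (d : ℝ) ^ 2)) * ((1 - 2 * (1 / 4 : ℝ)) ^ ((d : ℝ) / 2))⁻¹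
      ≤ Real.exp (-(1 / 4) * (16 * (d : ℝ) ^ 2)) * Real.exp d := by gcongr
    _ = Real.exp (-4 * d ^ 2 + d) := by
        rw [← Real.exp_add]
        ring_nf
    _ ≤ Real.exp (-(3 * d)) := by
        apply Real.exp_le_exp.2
        nlinarith
    _ ≤ 1 / (8 * d) := by
        rw [Real.exp_neg, ← one_div]
        apply one_div_le_one_div_of_le (by positivity)
        have h3 := Real.add_one_le_exp (d : ℝ)
        have h4 : Real.exp (3 * d) = Real.exp d ^ 3 := by
          rw [← Real.exp_nat_mul]
          norm_num
        rw [h4]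
        calc 8 * (d : ℝ) ≤ (d + 1) ^ 3 := by
              nlinarith [mul_nonneg (sub_nonneg.2 hd1) (sub_nonneg.2 hd1)]
          _ ≤ _ := by gcongr

/-- The event that the `i`-th difference vector of a block has a component of size at least `t`
orthogonal to the other difference vectors. -/
def separatedAt {d : ℕ} (t : ℝ) (i : Fin d) : Set (Fin (d + 1) → EuclideanSpace ℝ (Fin d)) :=
  {z | ∃ u : EuclideanSpace ℝ (Fin d), ‖u‖ = 1 ∧
    (∀ j, j ≠ i → inner ℝ u (z j.succ - z 0) = 0) ∧ t ≤ |inner ℝ u (z i.succ - z 0)|}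

/-- The existential over `u` is a projection of a closed set along the compact unit sphere.
Closedness is what gives measurability. -/
theorem isClosed_separatedAt {d : ℕ} (t : ℝ) (i : Fin d) : IsClosed (separatedAt t i) := by
  set K : Set (Metric.sphere (0 : EuclideanSpace ℝ (Fin d)) 1 ×
      (Fin (d + 1) → EuclideanSpace ℝ (Fin d))) :=
    {p | (∀ j, j ≠ i → inner ℝ (p.1 : EuclideanSpace ℝ (Fin d)) (p.2 j.succ - p.2 0) = 0) ∧
      t ≤ |inner ℝ (p.1 : EuclideanSpace ℝ (Fin d)) (p.2 i.succ - p.2 0)|} with hK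
  have hKc : IsClosed K := by
    rw [hK, Set.ofPred_and]
    refine IsClosed.inter ?_ (isClosed_le continuous_const (by fun_prop))
    simp only [Set.ofPred_forall]
    exact isClosed_iInter fun j => isClosed_iInter fun _ =>
      isClosed_eq (by fun_prop) continuous_const
  have himg : separatedAt t i = Prod.snd '' K := by
    ext z
    constructor
    · rintro ⟨u, hu, h1, h2⟩
      exact ⟨(⟨u, by simpa using hu⟩, z), ⟨h1, h2⟩, rfl⟩
    · rintro ⟨⟨⟨u, hu⟩, z'⟩, ⟨h1, h2⟩, rfl⟩
      exact ⟨u, by simpa using hu, h1, h2⟩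
  rw [himg]
  exact isClosedMap_snd_of_compactSpace _ hKc

/-- The other `d - 1` vectors span a proper subspace. -/
theorem exists_unit_orthogonal {d : ℕ} (i : Fin d) (w : Fin d → EuclideanSpace ℝ (Fin d)) :
    ∃ u : EuclideanSpace ℝ (Fin d), ‖u‖ = 1 ∧ ∀ j, j ≠ i → inner ℝ u (w j) = 0 := by
  set W := Submodule.span ℝ (w '' {j | j ≠ i}) with hW
  have hlt : Module.finrank ℝ W < d := by
    have h1 : ((Finset.univ.erase i).image w : Finset (EuclideanSpace ℝ (Fin d))) =
        w '' {j | j ≠ i} := by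
      ext x
      simp
    rw [hW, ← h1]
    refine (finrank_span_finset_le_card _).trans_lt (Finset.card_image_le.trans_lt ?_)
    rw [Finset.card_erase_of_mem (Finset.mem_univ i), Finset.card_univ, Fintype.card_fin]
    have := i.pos
    omega
  have hne : Wᗮ ≠ ⊥ := by
    intro h
    rw [Submodule.orthogonal_eq_bot_iff] at h
    rw [h, finrank_top, finrank_euclideanSpace, Fintype.card_fin] at hlt
    exact hlt.false
  obtain ⟨v, hv, hv0⟩ := Submodule.exists_mem_ne_zero_of_ne_bot hne
  refine ⟨‖v‖⁻¹ • v, norm_smul_inv_norm hv0, fun j hj => ?_⟩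
  rw [inner_smul_left, real_inner_comm,
    (Submodule.mem_orthogonal _ _).1 hv (w j) (Submodule.subset_span ⟨j, hj, rfl⟩), mul_zero]

/-- Fix all points except `z i.succ`. The other differences then determine a unit normal `u`
independent of that point, and failure forces the point into the slab of half-width `t` around the
level `⟨u, z 0⟩`. Integrating out this single coordinate gives the bound. -/
theorem measure_separatedAt_compl_le {d : ℕ} (t : ℝ) (i : Fin d) :
    Measure.pi (fun _ : Fin (d + 1) => stdGaussian (EuclideanSpace ℝ (Fin d)))
      (separatedAt t i)ᶜ ≤ ENNReal.ofReal t := by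
  have hm : MeasurableSet (separatedAt t i)ᶜ := (isClosed_separatedAt t i).measurableSet.compl
  rw [← lintegral_indicator_one hm]
  have hc : ENNReal.ofReal t = ∫⁻ _ : Fin (d + 1) → EuclideanSpace ℝ (Fin d), ENNReal.ofReal t
      ∂(Measure.pi (fun _ : Fin (d + 1) => stdGaussian (EuclideanSpace ℝ (Fin d)))) := by
    simp
  rw [hc]
  refine lintegral_le_of_lmarginal_le {i.succ} (measurable_one.indicator hm) measurable_const ?_
  intro z
  rw [lmarginal_singleton, lmarginal_singleton, lintegral_const, measure_univ, mul_one]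
  obtain ⟨u, hu, h0⟩ := exists_unit_orthogonal i (fun j => z j.succ - z 0)
  refine le_trans ?_ (stdGaussian_slab_le hu (inner ℝ u (z 0)) t)
  have hms : MeasurableSet {x : EuclideanSpace ℝ (Fin d) | |inner ℝ u x - inner ℝ u (z 0)| ≤ t} :=
    measurableSet_le (by fun_prop) measurable_const
  rw [← lintegral_indicator_one hms]
  refine lintegral_mono fun y => ?_
  change (separatedAt t i)ᶜ.indicator (1 : (Fin (d + 1) → EuclideanSpace ℝ (Fin d)) → ENNReal)
    (Function.update z i.succ y) ≤ _
  by_cases hy : Function.update z i.succ y ∈ (separatedAt t i)ᶜ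
  swap
  · rw [Set.indicator_of_notMem hy]
    exact zero_le
  rw [Set.indicator_of_mem hy]
  have hmem : y ∈ {x : EuclideanSpace ℝ (Fin d) | |inner ℝ u x - inner ℝ u (z 0)| ≤ t} := by
    by_contra hlt
    refine hy ⟨u, hu, fun j hj => ?_, ?_⟩
    · rw [Function.update_of_ne (by simpa using hj), Function.update_of_ne (Fin.succ_ne_zero i).symm]
      exact h0 j hj
    · rw [Function.update_self, Function.update_of_ne (Fin.succ_ne_zero i).symm, inner_sub_right]
      exact (not_le.1 hlt).le
  rw [Set.indicator_of_mem hmem]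
  rfl

theorem goodBlock_eq (d : ℕ) :
    goodBlock d = (⋂ i, {z | ‖z i‖ ≤ 4 * d}) ∩ ⋂ i, separatedAt (1 / (4 * d : ℝ)) i := by
  ext z
  simp [goodBlock, separatedAt]

theorem measurableSet_goodBlock (d : ℕ) : MeasurableSet (goodBlock d) := by
  rw [goodBlock_eq]
  exact (MeasurableSet.iInter fun i => measurableSet_le (by fun_prop) measurable_const).inter
    (MeasurableSet.iInter fun i => (isClosed_separatedAt _ i).measurableSet)

/-- Union bound: large norms cost `(d + 1) / (8 d) ≤ 1/4`, poor separation costs `d / (4 d) = 1/4`.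
-/
theorem measure_goodBlock_compl_le {d : ℕ} (hd : 1 ≤ d) :
    Measure.pi (fun _ : Fin (d + 1) => stdGaussian (EuclideanSpace ℝ (Fin d)))
      (goodBlock d)ᶜ ≤ ENNReal.ofReal (1 / 2) := by
  have hd1 : (1 : ℝ) ≤ d := by exact_mod_cast hd
  set P := Measure.pi (fun _ : Fin (d + 1) => stdGaussian (EuclideanSpace ℝ (Fin d)))
  rw [goodBlock_eq, Set.compl_inter, Set.compl_iInter, Set.compl_iInter]
  have h1 : P (⋃ i, {z : Fin (d + 1) → EuclideanSpace ℝ (Fin d) | ‖z i‖ ≤ 4 * d}ᶜ) ≤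
      ENNReal.ofReal (1 / 4) := by
    calc _ ≤ ∑ i : Fin (d + 1), P {z | ‖z i‖ ≤ 4 * d}ᶜ := measure_iUnion_fintype_le _ _
      _ ≤ ∑ i : Fin (d + 1), ENNReal.ofReal (1 / (8 * d)) := by
          refine Finset.sum_le_sum fun i _ => ?_
          have h2 := (measurePreserving_eval (fun _ : Fin (d + 1) =>
            stdGaussian (EuclideanSpace ℝ (Fin d))) i).measure_preimage
            (s := {x | 4 * (d : ℝ) < ‖x‖}) (measurableSet_lt (by fun_prop)
              (by fun_prop)).nullMeasurableSet
          refine le_trans (le_of_eq ?_) (h2.trans_le (stdGaussian_norm_gt_le hd))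
          congr 1
          ext z
          simp
      _ ≤ ENNReal.ofReal (1 / 4) := by
          rw [Finset.sum_const, Finset.card_univ, Fintype.card_fin, nsmul_eq_mul,
            ← ENNReal.ofReal_natCast, ← ENNReal.ofReal_mul (by positivity)]
          apply ENNReal.ofReal_le_ofReal
          rw [mul_one_div, div_le_div_iff₀ (by positivity) (by norm_num)]
          push_cast
          linarith
  have h2 : P (⋃ i, (separatedAt (1 / (4 * d : ℝ)) i)ᶜ) ≤ ENNReal.ofReal (1 / 4) := by
    calc _ ≤ ∑ i : Fin d, P (separatedAt (1 / (4 * d : ℝ)) i)ᶜ := measure_iUnion_fintype_le _ _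
      _ ≤ ∑ i : Fin d, ENNReal.ofReal (1 / (4 * d)) :=
          Finset.sum_le_sum fun i _ => measure_separatedAt_compl_le _ i
      _ = ENNReal.ofReal (1 / 4) := by
          rw [Finset.sum_const, Finset.card_univ, Fintype.card_fin, nsmul_eq_mul,
            ← ENNReal.ofReal_natCast, ← ENNReal.ofReal_mul (by positivity)]
          congr 1
          field_simp
  refine (measure_union_le _ _).trans ((add_le_add h1 h2).trans (le_of_eq ?_))
  rw [← ENNReal.ofReal_add (by norm_num) (by norm_num)]
  norm_num

/-- Splitting an i.i.d. sample into blocks gives i.i.d. blocks. -/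
theorem pi_map_blocks {X ι κ τ : Type*} [Fintype ι] [Fintype κ] [Fintype τ] [MeasurableSpace X]
    (P : Measure X) [IsProbabilityMeasure P] (e : κ × ι ≃ τ) :
    (Measure.pi (fun _ : τ => P)).map (fun x (j : κ) (i : ι) => x (e (j, i))) =
      Measure.pi (fun _ : κ => Measure.pi (fun _ : ι => P)) := by
  have hm : Measurable (fun (g : κ → ι → X) (p : τ) => g (e.symm p).1 (e.symm p).2) := by fun_prop
  -- The inverse reindexing is treated first, since a product measure is characterised by its values
  -- on boxes.
  have h : Measure.pi (fun _ : τ => P) = (Measure.pi (fun _ : κ => Measure.pi (fun _ : ι => P))).map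
      (fun (g : κ → ι → X) (p : τ) => g (e.symm p).1 (e.symm p).2) := by
    refine Measure.pi_eq fun s hs => ?_
    rw [Measure.map_apply hm (MeasurableSet.univ_pi hs)]
    have hpre : (fun (g : κ → ι → X) (p : τ) => g (e.symm p).1 (e.symm p).2) ⁻¹' Set.univ.pi s =
        Set.univ.pi (fun j => Set.univ.pi (fun i => s (e (j, i)))) := by
      ext g
      simp only [Set.mem_preimage, Set.mem_pi, Set.mem_univ, true_imp_iff]
      constructor
      · intro hg j i
        simpa using hg (e (j, i))
      · intro hg p
        simpa using hg (e.symm p).1 (e.symm p).2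
    rw [hpre, Measure.pi_pi]
    simp_rw [Measure.pi_pi]
    rw [← Fintype.prod_prod_type', ← e.prod_comp]
  rw [h, Measure.map_map (by fun_prop) hm]
  convert Measure.map_id
  ext g j i
  simp

end GoodBlockProbability

/-! ### The grid of coefficients, the algorithm, its failure probability and the size of its list.
-/

section Algorithm

/-- The `k`-th of the `2 * N + 1` points of the grid of mesh `η` centred at `0`. -/
def gridPoint (N : ℕ) (η : ℝ) (k : Fin (2 * N + 1)) : ℝ := η * ((k : ℕ) - N : ℝ)

theorem exists_gridPoint_near {N : ℕ} {η r : ℝ} (hη : 0 < η) (hr : |r| ≤ η * N) :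
    ∃ k : Fin (2 * N + 1), |gridPoint N η k - r| ≤ η := by
  obtain ⟨h1, h2⟩ := abs_le.1 hr
  have h3 : -(N : ℝ) ≤ r / η := by rw [le_div_iff₀ hη]; linarith
  have h4 : r / η ≤ N := by rw [div_le_iff₀ hη]; linarith
  have h5 : 0 ≤ r / η + N := by linarith
  have h6 : ⌊r / η + N⌋₊ < 2 * N + 1 := by
    rw [Nat.floor_lt h5]
    push_cast
    linarith
  refine ⟨⟨_, h6⟩, ?_⟩
  have h7 := Nat.floor_le h5
  have h8 := (Nat.lt_floor_add_one (r / η + N)).le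
  have h9 : gridPoint N η ⟨_, h6⟩ - r = η * ((⌊r / η + N⌋₊ : ℝ) - (r / η + N)) := by
    simp only [gridPoint]
    field_simp
    ring
  rw [h9, abs_mul, abs_of_pos hη]
  refine mul_le_of_le_one_right hη.le (abs_le.2 ⟨by linarith, by linarith⟩)

/-- The indices of the coefficients of the candidates of a block. -/
abbrev CoefficientIndex (d N : ℕ) : Type :=
  (Fin d → Fin (2 * N + 1)) × (Fin d → Fin d → Fin (2 * N + 1))

/-- The candidate of a block with coefficients on the grid. -/
noncomputable def gridCandidate {d : ℕ} (N : ℕ) (η : ℝ)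
    (x : Fin (d + 1) → EuclideanSpace ℝ (Fin d)) (c : CoefficientIndex d N) :
    Measure (EuclideanSpace ℝ (Fin d)) :=
  blockCandidate x (WithLp.toLp 2 fun i => gridPoint N η (c.1 i))
    (Matrix.of fun i j => gridPoint N η (c.2 i j))

theorem exists_gridCandidate_near {d : ℕ} (hd : 1 ≤ d) {α : ℝ} (hα : 0 < α) (hα1 : α < 1) {N : ℕ}
    (hN : 7680 * (d : ℝ) ^ 6 / α ≤ N) {R : Matrix (Fin d) (Fin d) ℝ} (hR : R.det ≠ 0)
    (μ : EuclideanSpace ℝ (Fin d)) {z : Fin (d + 1) → EuclideanSpace ℝ (Fin d)}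
    (hz : z ∈ goodBlock d) :
    ∃ c, tvDist (gridCandidate N (α / (480 * d ^ 4)) (fun i => affineImage μ R (z i)) c)
      ((stdGaussian _).map (affineImage μ R)) ≤ α := by
  have hd1 : (1 : ℝ) ≤ d := by exact_mod_cast hd
  have hη : 0 < α / (480 * (d : ℝ) ^ 4) := by positivity
  -- The grid must reach the largest coefficient, `16 d²`; hence `7680 = 16 · 480`.
  have hbound : 16 * (d : ℝ) ^ 2 ≤ α / (480 * d ^ 4) * N := by
    rw [div_le_iff₀ hα] at hN
    rw [div_mul_eq_mul_div, le_div_iff₀ (by positivity)]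
    nlinarith
  have hbound2 : 4 * (d : ℝ) ≤ 16 * d ^ 2 := by nlinarith
  obtain ⟨v, A, hv, hA, hvb, hAb⟩ := exists_inverse_of_mem_goodBlock hd hz
  choose c₁ hc₁ using fun i => exists_gridPoint_near hη ((hvb i).trans hbound)
  choose c₂ hc₂ using fun i j => exists_gridPoint_near hη (((hAb i j).trans hbound2).trans hbound)
  exact ⟨(c₁, c₂), tvDist_blockCandidate_le hd hα hα1 hR μ hz hv hA hc₁ hc₂⟩

theorem measurable_sigmaMk {ι : Type*} {Y : ι → Type*} [∀ i, MeasurableSpace (Y i)] (i : ι) :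
    Measurable (Sigma.mk i : Y i → Σ i, Y i) :=
  Measurable.of_le_map (iInf_le _ i)

/-- The number of candidates produced from `k` blocks. -/
def listLength (d k N : ℕ) : ℕ := k * ((2 * N + 1) ^ d * ((2 * N + 1) ^ d) ^ d)

theorem card_index (d k N : ℕ) :
    Fintype.card (Fin k × CoefficientIndex d N) = listLength d k N := by
  simp [listLength]

/-- The list of the grid candidates of all blocks of the sample. -/
noncomputable def blockList (d k N : ℕ) (η : ℝ)
    (ω : unitInterval × (Fin (k * (d + 1)) → EuclideanSpace ℝ (Fin d))) :
    -- `Fin.last` selects the maximal length, so the list always has exactly `listLength d k N`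
    -- entries.
    CandidateList (EuclideanSpace ℝ (Fin d)) (listLength d k N) :=
  ⟨Fin.last _, fun l : Fin (listLength d k N) =>
    gridCandidate N η
      (fun i => ω.2 (finProdFinEquiv (((Fintype.equivFinOfCardEq (card_index d k N)).symm l).1, i)))
      ((Fintype.equivFinOfCardEq (card_index d k N)).symm l).2⟩

theorem measurable_blockList (d k N : ℕ) (η : ℝ) : Measurable (blockList d k N η) := by
  refine (measurable_sigmaMk (Y := fun n : Fin (listLength d k N + 1) =>
    Fin n → Measure (EuclideanSpace ℝ (Fin d))) (Fin.last _)).comp ?_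
  refine measurable_pi_lambda _ fun l => ?_
  exact (measurable_blockCandidate _ _).comp
    (measurable_pi_lambda _ fun i => (measurable_pi_apply _).comp measurable_snd)

/-- Here `T` undoes the unknown affine map, so the `k` blocks become independent standard Gaussian
blocks, each bad with probability at most 1/2. -/
theorem measure_forall_block_notMem_le {d : ℕ} (hd : 1 ≤ d) (k : ℕ)
    {μ : EuclideanSpace ℝ (Fin d)} {R : Matrix (Fin d) (Fin d) ℝ}
    {T : EuclideanSpace ℝ (Fin d) → EuclideanSpace ℝ (Fin d)} (hT : Measurable T)
    (hTR : ∀ y, T (affineImage μ R y) = y) :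
    Measure.pi (fun _ : Fin (k * (d + 1)) => (stdGaussian _).map (affineImage μ R))
      {x | ∀ j, (fun i => T (x (finProdFinEquiv (j, i)))) ∉ goodBlock d} ≤
      ENNReal.ofReal ((1 / 2) ^ k) := by
  have hm : Measurable (affineImage μ R) :=
    (continuous_affineImage.comp (Continuous.prodMk_right (μ, R))).measurable
  have hprob : IsProbabilityMeasure ((stdGaussian _).map (affineImage μ R)) :=
    Measure.isProbabilityMeasure_map hm.aemeasurable
  set D : Set (Fin (d + 1) → EuclideanSpace ℝ (Fin d)) :=
    (fun x i => T (x i)) ⁻¹' (goodBlock d)ᶜ with hD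
  have hTm : Measurable fun (x : Fin (d + 1) → EuclideanSpace ℝ (Fin d)) i => T (x i) := by fun_prop
  have hDm : MeasurableSet D := hTm (measurableSet_goodBlock d).compl
  have hDle : Measure.pi (fun _ : Fin (d + 1) => (stdGaussian _).map (affineImage μ R)) D ≤
      ENNReal.ofReal (1 / 2) := by
    rw [← Measure.pi_map_pi (fun _ => hm.aemeasurable), Measure.map_apply (by fun_prop) hDm]
    refine le_trans (le_of_eq ?_) (measure_goodBlock_compl_le hd)
    congr 1
    ext z
    simp [hD, hTR]
  have hset : {x : Fin (k * (d + 1)) → EuclideanSpace ℝ (Fin d) |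
        ∀ j, (fun i => T (x (finProdFinEquiv (j, i)))) ∉ goodBlock d} =
      (fun x (j : Fin k) (i : Fin (d + 1)) => x (finProdFinEquiv (j, i))) ⁻¹'
        Set.univ.pi (fun _ => D) := by
    ext x
    simp [hD]
  rw [hset, ← Measure.map_apply (by fun_prop) (MeasurableSet.univ_pi fun _ => hDm),
    pi_map_blocks, Measure.pi_pi, Finset.prod_const, Finset.card_univ, Fintype.card_fin,
    ENNReal.ofReal_pow (by norm_num)]
  gcongr

open scoped MatrixOrder in
theorem exists_map_affineImage_eq_multivariateGaussian {d : ℕ} (μ : EuclideanSpace ℝ (Fin d))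
    {S : Matrix (Fin d) (Fin d) ℝ} (hS : S.PosDef) :
    ∃ R : Matrix (Fin d) (Fin d) ℝ, R.det ≠ 0 ∧
      multivariateGaussian μ S = (stdGaussian _).map (affineImage μ R) := by
  -- The multivariate Gaussian is by definition the image of the standard one under `μ + √S x`,
  -- hence `rfl`. Invertibility follows from `(det √S)² = det S > 0`.
  refine ⟨CFC.sqrt S, fun h0 => ?_, rfl⟩
  have hRR : CFC.sqrt S * CFC.sqrt S = S := CFC.sqrt_mul_sqrt_self S hS.posSemidef.nonneg
  have hdet := hS.det_pos
  rw [← hRR, Matrix.det_mul, h0, mul_zero] at hdet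
  exact hdet.false

theorem isListDecodingAlgorithm_blockList {d : ℕ} (hd : 1 ≤ d) {α β : ℝ} (hα : 0 < α)
    (hα1 : α < 1) {k N : ℕ} (hN : 7680 * (d : ℝ) ^ 6 / α ≤ N) (hk : (1 / 2 : ℝ) ^ k ≤ β) :
    IsListDecodingAlgorithm (gaussianClass d) tvDist (listLength d k N) (k * (d + 1)) α β 0
      (blockList d k N (α / (480 * d ^ 4))) where
  measurable := measurable_blockList _ _ _ _
  output_mem _ _ := gaussianCandidate_mem _ _
  failure_le := by
    rintro f ⟨μ, S, hS, rfl⟩ h hh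
    obtain ⟨R, hR, hmv⟩ := exists_map_affineImage_eq_multivariateGaussian μ hS
    obtain ⟨e, he⟩ := exists_equiv_of_det_ne_zero hR
    have hmix : huberMixture 0 (multivariateGaussian μ S) h =
        (stdGaussian _).map (affineImage μ R) := by
      simp [huberMixture, hmv]
    rw [hmix, hmv]
    set T : EuclideanSpace ℝ (Fin d) → EuclideanSpace ℝ (Fin d) := fun y => e.symm (y - μ) with hT
    have hTm : Measurable T := by fun_prop
    have hTR : ∀ y, T (affineImage μ R y) = y := by
      intro y
      simp [hT, affineImage, ← he]
    have hRT : ∀ y, affineImage μ R (T y) = y := by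
      intro y
      simp only [hT, affineImage, ← he, ContinuousLinearEquiv.apply_symm_apply]
      abel
    -- One good standardised block already puts a close candidate on the list, so failure forces
    -- every block to be bad, whatever the seed.
    refine (measure_mono (t := Set.univ ×ˢ {x : Fin (k * (d + 1)) → EuclideanSpace ℝ (Fin d) |
      ∀ j, (fun i => T (x (finProdFinEquiv (j, i)))) ∉ goodBlock d}) ?_).trans ?_
    · rintro ⟨s, x⟩ hfail
      refine ⟨Set.mem_univ _, fun j hj => hfail ?_⟩
      obtain ⟨c, hc⟩ := exists_gridCandidate_near hd hα hα1 hN hR μ hj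
      simp only [hRT] at hc
      refine ⟨(Fintype.equivFinOfCardEq (card_index d k N)) (j, c), ?_⟩
      simp only [blockList, Equiv.symm_apply_apply]
      exact hc
    · rw [Measure.prod_prod, measure_univ, one_mul]
      exact (measure_forall_block_notMem_le hd k hTm hTR).trans (ENNReal.ofReal_le_ofReal hk)

theorem two_mul_ceil_add_one_le {d : ℕ} (hd : 1 ≤ d) {α : ℝ} (hα : 0 < α) (hα1 : α < 1) :
    (2 * ⌈7680 * (d : ℝ) ^ 6 / α⌉₊ + 1 : ℝ) ≤
      Real.exp (18 * (max 1 (Real.log (1 / α)) *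
        (1 + Real.log ((d : ℝ) ^ 2 * max 1 (Real.log (1 / α)))))) := by
  have hd1 : (1 : ℝ) ≤ d := by exact_mod_cast hd
  set a := max 1 (Real.log (1 / α)) with ha
  have ha1 : 1 ≤ a := le_max_left _ _
  have hlogd : 0 ≤ Real.log d := Real.log_nonneg hd1
  have hlog : 2 * Real.log d ≤ Real.log ((d : ℝ) ^ 2 * a) := by
    rw [Real.log_mul (by positivity) (by positivity), Real.log_pow]
    push_cast
    linarith [Real.log_nonneg ha1]
  have h1 : 1 ≤ (d : ℝ) ^ 6 / α := by
    rw [le_div_iff₀ hα]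
    nlinarith [one_le_pow₀ hd1 (n := 6)]
  calc (2 * ⌈7680 * (d : ℝ) ^ 6 / α⌉₊ + 1 : ℝ) ≤ 2 * (7680 * (d : ℝ) ^ 6 / α + 1) + 1 := by
        gcongr
        exact (Nat.ceil_lt_add_one (by positivity)).le
    _ ≤ 2 ^ 14 * (d : ℝ) ^ 6 * (1 / α) := by
        rw [mul_div_assoc, mul_one_div, mul_div_assoc]
        linarith
    _ ≤ Real.exp 1 ^ 14 * Real.exp (Real.log d) ^ 6 * Real.exp (Real.log (1 / α)) := by
        rw [Real.exp_log (by positivity), Real.exp_log (by positivity)]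
        gcongr
        linarith [Real.add_one_le_exp 1]
    _ = Real.exp (14 + 6 * Real.log d + Real.log (1 / α)) := by
        rw [Real.exp_add, Real.exp_add, ← Real.exp_nat_mul, ← Real.exp_nat_mul]
        norm_num
    -- With `h = 1 + log (d² a)`, one has `6 log d ≤ 3 (h - 1)`, and `14 + 3 (h - 1) + a ≤ 18 a h`
    -- since `a, h ≥ 1`.
    _ ≤ _ := by
        apply Real.exp_le_exp.2
        have h2 : Real.log (1 / α) ≤ a := le_max_right _ _
        nlinarith

theorem listLength_le {d : ℕ} (hd : 1 ≤ d) {α β : ℝ} (hα : 0 < α) (hα1 : α < 1) (hβ : 0 < β)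
    (hβ1 : β < 1) :
    (listLength d ⌈2 * Real.log (1 / β)⌉₊ ⌈7680 * (d : ℝ) ^ 6 / α⌉₊ : ℝ) ≤
      (max 2 (d * Real.log (1 / β))) ^
        polylogBound 75 1 ((d : ℝ) ^ 2 * max 1 (Real.log (1 / α))) := by
  have hd1 : (1 : ℝ) ≤ d := by exact_mod_cast hd
  set b := max 2 (d * Real.log (1 / β)) with hb
  set a := max 1 (Real.log (1 / α)) with ha
  have ha1 : 1 ≤ a := le_max_left _ _
  have hb2 : 2 ≤ b := le_max_left _ _
  have hb0 : 0 < b := by linarith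
  set h := 1 + Real.log ((d : ℝ) ^ 2 * a) with hh
  have hg1 : 1 ≤ (d : ℝ) ^ 2 * a := by nlinarith
  have hh1 : 1 ≤ h := by linarith [Real.log_nonneg hg1]
  have hl : 0 < Real.log (1 / β) := Real.log_pos (by rw [lt_div_iff₀ hβ]; linarith)
  have hlb : Real.log (1 / β) ≤ b := le_trans (by nlinarith) (le_max_right _ _)
  have hk : (⌈2 * Real.log (1 / β)⌉₊ : ℝ) ≤ b ^ (3 : ℝ) := by
    have h1 := (Nat.ceil_lt_add_one (show 0 ≤ 2 * Real.log (1 / β) by positivity)).le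
    rw [show (3 : ℝ) = (3 : ℕ) by norm_num, Real.rpow_natCast]
    nlinarith [mul_nonneg hb0.le (mul_nonneg (sub_nonneg.2 hb2) (by linarith : 0 ≤ b + 2))]
  -- Changing the base from `e` to `b ≥ 2` doubles 18, because `log b ≥ 1/2`.
  have hN : (2 * ⌈7680 * (d : ℝ) ^ 6 / α⌉₊ + 1 : ℝ) ≤ b ^ (36 * (a * h)) := by
    refine (two_mul_ceil_add_one_le hd hα hα1).trans ?_
    rw [← ha, ← hh, Real.rpow_def_of_pos hb0]
    apply Real.exp_le_exp.2
    have h1 : 1 / 2 ≤ Real.log b := by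
      have := Real.log_le_log (by norm_num) hb2
      linarith [Real.log_two_gt_d9]
    nlinarith [mul_nonneg (by positivity : 0 ≤ a * h) (sub_nonneg.2 h1)]
  rw [listLength, ← pow_mul, ← pow_add]
  push_cast
  calc _ ≤ b ^ (3 : ℝ) * (b ^ (36 * (a * h))) ^ (d + d * d) := by gcongr
    _ = b ^ (3 + 36 * (a * h) * ((d + d * d : ℕ) : ℝ)) := by
        rw [← Real.rpow_natCast, ← Real.rpow_mul hb0.le, ← Real.rpow_add hb0]
    -- `d + d² ≤ 2 d²` gives the exponent `3 + 72 d² a h ≤ 75 d² a h`, the source of the constant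
    -- 75.
    _ ≤ _ := by
        apply Real.rpow_le_rpow_of_exponent_le (by linarith)
        rw [polylogBound, pow_one, ← hh]
        push_cast
        have h1 : 1 ≤ d ^ 2 * a * h := one_le_mul_of_one_le_of_one_le hg1 hh1
        have h2 : (d + d * d : ℝ) ≤ 2 * d ^ 2 := by nlinarith
        have h3 := mul_le_mul_of_nonneg_left h2 (by positivity : 0 ≤ 36 * (a * h))
        nlinarith

end Algorithm

theorem lemma7p4 :
    ∃ (C : ℝ) (p : ℕ), 0 < C ∧
      ∀ (d : ℕ), 1 ≤ d →
      ∀ (α β : ℝ), 0 < α → α < 1 → 0 < β → β < 1 →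
        ∃ L m : ℕ,
          (m : ℝ) ≤ C * (d * max 1 (Real.log (1 / β))) ∧
          (L : ℝ) ≤ (max 2 (d * Real.log (1 / β))) ^
            polylogBound C p ((d : ℝ) ^ 2 * max 1 (Real.log (1 / α))) ∧
          IsListDecodable (gaussianClass d) tvDist L m α β 0 := by
  refine ⟨75, 1, by norm_num, fun d hd α β hα hα1 hβ hβ1 => ⟨_, _, ?_,
    listLength_le hd hα hα1 hβ hβ1, _, isListDecodingAlgorithm_blockList hd hα hα1
      (Nat.le_ceil _) ?_⟩⟩
  · have hd1 : (1 : ℝ) ≤ d := by exact_mod_cast hd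
    have hl : 0 < Real.log (1 / β) := Real.log_pos (by rw [lt_div_iff₀ hβ]; linarith)
    have h1 := (Nat.ceil_lt_add_one (show 0 ≤ 2 * Real.log (1 / β) by positivity)).le
    have h2 : 1 ≤ max 1 (Real.log (1 / β)) := le_max_left _ _
    have h3 : Real.log (1 / β) ≤ max 1 (Real.log (1 / β)) := le_max_right _ _
    push_cast
    calc (⌈2 * Real.log (1 / β)⌉₊ : ℝ) * (d + 1)
        ≤ (3 * max 1 (Real.log (1 / β))) * (2 * d) := by gcongr <;> linarith
      _ ≤ 75 * (d * max 1 (Real.log (1 / β))) := by nlinarith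
  -- Because `1/2 ≤ exp (-1/2)`, taking `2 log (1/β)` blocks suffices for `2^(-k) ≤ β`.
  · have h1 : (1 / 2 : ℝ) ≤ Real.exp (-(1 / 2)) := by
      linarith [Real.add_one_le_exp (-(1 / 2) : ℝ)]
    calc (1 / 2 : ℝ) ^ ⌈2 * Real.log (1 / β)⌉₊
        ≤ Real.exp (-(1 / 2)) ^ ⌈2 * Real.log (1 / β)⌉₊ := by gcongr
      _ = Real.exp (-(⌈2 * Real.log (1 / β)⌉₊ / 2)) := by
          rw [← Real.exp_nat_mul]
          ring_nf
      _ ≤ Real.exp (-Real.log (1 / β)) := by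
          apply Real.exp_le_exp.2
          linarith [Nat.le_ceil (2 * Real.log (1 / β))]
      _ = β := by
          rw [one_div, Real.log_inv, neg_neg, Real.exp_log hβ]
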